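/- **Theorem (Van Kampen).** Let $X$ be a topological space, let $U$ and $V$ be open subsets of $X$ with $X=U\cup V$, and put $W=U\cap V$. For a space $Y$ let $\Pi_1(Y)$ denote its fundamental groupoid (objects: the points of $Y$; morphisms: homotopy classes, relative to the end points, of paths in $Y$). Consider the commutative square of groupoids $$\begin{array}{ccc}\Pi_1(W)&\longrightarrow&\Pi_1(U)\\ \downarrow&&\downarrow\\ \Pi_1(V)&\longrightarrow&\Pi_1(X)\end{array}$$ induced by the inclusions. For a groupoid $\mathsf G$ and a space $Y$ write $\hom(\Pi_1(Y),\mathsf G)$ for the groupoid of functors $\Pi_1(Y)\to\mathsf G$ and natural transformations, and for $Z\in\{U,V\}$ write $\chi\mapsto\chi|_W$ for the composition with $\Pi_1(W)\to\Pi_1(Z)$, on functors and on natural transformations; similarly for restriction from $X$ to $U$, $V$, $W$. Then the square is simultaneously a pushout and a $2$-pushout of groupoids, that is: 1. (Pushout.) The square is a pushout square in the category of small groupoids. Moreover, for every groupoid $\mathsf G$ the functor $\chi\mapsto(\chi|_W,\chi|_U,\chi|_V)$ is an isomorphism of groupoids from $\hom(\Pi_1(X),\mathsf G)$ to the limit of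 $\hom(\Pi_1(U),\mathsf G)\to\hom(\Pi_1(W),\mathsf G)\leftarrow\hom(\Pi_1(V),\mathsf G)$. The objects of this limit are the triples $(x_W,x_U,x_V)$ of functors $x_Z:\Pi_1(Z)\to\mathsf G$ with $x_U|_W=x_W=x_V|_W$; its morphisms are the triples $(f_W,f_U,f_V)$ of natural transformations with $f_U|_W=f_W=f_V|_W$. 2. ($2$-pushout.) For every groupoid $\mathsf G$ the functor $\chi\mapsto(\chi|_W,\chi|_U,\chi|_V,\mathrm{id},\mathrm{id})$ is an equivalence of groupoids from $\hom(\Pi_1(X),\mathsf G)$ to the $2$-limit of the same diagram. The objects of this $2$-limit are the families $(x_W,x_U,x_V,\xi_U,\xi_V)$ of functors $x_Z:\Pi_1(Z)\to\mathsf G$ and natural isomorphisms $\xi_U:x_U|_W\Rightarrow x_W$, $\xi_V:x_V|_W\Rightarrow x_W$; its morphisms $(x,\xi)\to(y,\eta)$ are the triples $(f_W,f_U,f_V)$ of natural transformations $f_Z:x_Z\Rightarrow y_Z$ with $\eta_Z\circ(f_Z|_W)=f_W\circ\xi_Z$ for $Z=U,V$. -/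

import Mathlib

open CategoryTheory

namespace VanKampen

universe v₀ v₁ v₂ v₃ u₀ u₁ u₂ u₃

section Limits

variable {X : Type u₀} {Y : Type u₁} {Z : Type u₂}
  [Category.{v₀} X] [Category.{v₁} Y] [Category.{v₂} Z]

/-- Objects of the limit of the diagram of categories `p : Y ⥤ X`, `q : Z ⥤ X`: families of objects
which are strictly compatible with the transition functors. -/
structure Lim (p : Y ⥤ X) (q : Z ⥤ X) where
  /-- the component in the common target of the diagram -/
  base : X
  /-- the component in the first source of the diagram -/
  fst : Y
  /-- the component in the second source of the diagram -/
  snd : Z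
  fst_eq : p.obj fst = base
  snd_eq : q.obj snd = base

namespace Lim

variable {p : Y ⥤ X} {q : Z ⥤ X}

/-- Morphisms of the limit: families of morphisms which are compatible with the transition
functors. The morphism `eqToHom` only identifies objects which are equal. -/
@[ext]
structure Hom (s t : Lim p q) where
  /-- the component in the common target of the diagram -/
  base : s.base ⟶ t.base
  /-- the component in the first source of the diagram -/
  fst : s.fst ⟶ t.fst
  /-- the component in the second source of the diagram -/
  snd : s.snd ⟶ t.snd
  fst_w : p.map fst ≫ eqToHom t.fst_eq = eqToHom s.fst_eq ≫ base
  snd_w : q.map snd ≫ eqToHom t.snd_eq = eqToHom s.snd_eq ≫ base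

instance : Category (Lim p q) where
  Hom := Hom
  id s := ⟨𝟙 _, 𝟙 _, 𝟙 _, by simp, by simp⟩
  comp f g := ⟨f.base ≫ g.base, f.fst ≫ g.fst, f.snd ≫ g.snd,
    by rw [p.map_comp, Category.assoc, g.fst_w, ← Category.assoc, f.fst_w, Category.assoc],
    by rw [q.map_comp, Category.assoc, g.snd_w, ← Category.assoc, f.snd_w, Category.assoc]⟩
  id_comp _ := Hom.ext (Category.id_comp _) (Category.id_comp _) (Category.id_comp _)
  comp_id _ := Hom.ext (Category.comp_id _) (Category.comp_id _) (Category.comp_id _)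
  assoc _ _ _ :=
    Hom.ext (Category.assoc _ _ _) (Category.assoc _ _ _) (Category.assoc _ _ _)

end Lim

/-- Objects of the 2-limit of the diagram of categories `p : Y ⥤ X`, `q : Z ⥤ X`: families of
objects together with isomorphisms expressing their compatibility with the transition functors.
(The diagram has no two composable non-identity arrows, and the cocycle condition says that the
isomorphisms attached to identity arrows are identities; hence only the two isomorphisms below
have to be given, and they are subject to no further condition.) -/
structure TwoLim (p : Y ⥤ X) (q : Z ⥤ X) where
  /-- the component in the common target of the diagram -/
  base : X
  /-- the component in the first source of the diagram -/
  fst : Y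
  /-- the component in the second source of the diagram -/
  snd : Z
  /-- the compatibility isomorphism along `p` -/
  fstIso : p.obj fst ≅ base
  /-- the compatibility isomorphism along `q` -/
  sndIso : q.obj snd ≅ base

namespace TwoLim

variable {p : Y ⥤ X} {q : Z ⥤ X}

/-- Morphisms of the 2-limit: families of morphisms which commute with the compatibility
isomorphisms. -/
@[ext]
structure Hom (s t : TwoLim p q) where
  /-- the component in the common target of the diagram -/
  base : s.base ⟶ t.base
  /-- the component in the first source of the diagram -/
  fst : s.fst ⟶ t.fst
  /-- the component in the second source of the diagram -/
  snd : s.snd ⟶ t.snd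
  fst_w : p.map fst ≫ t.fstIso.hom = s.fstIso.hom ≫ base
  snd_w : q.map snd ≫ t.sndIso.hom = s.sndIso.hom ≫ base

instance : Category (TwoLim p q) where
  Hom := Hom
  id s := ⟨𝟙 _, 𝟙 _, 𝟙 _, by simp, by simp⟩
  comp f g := ⟨f.base ≫ g.base, f.fst ≫ g.fst, f.snd ≫ g.snd,
    by rw [p.map_comp, Category.assoc, g.fst_w, ← Category.assoc, f.fst_w, Category.assoc],
    by rw [q.map_comp, Category.assoc, g.snd_w, ← Category.assoc, f.snd_w, Category.assoc]⟩
  id_comp _ := Hom.ext (Category.id_comp _) (Category.id_comp _) (Category.id_comp _)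
  comp_id _ := Hom.ext (Category.comp_id _) (Category.comp_id _) (Category.comp_id _)
  assoc _ _ _ :=
    Hom.ext (Category.assoc _ _ _) (Category.assoc _ _ _) (Category.assoc _ _ _)

end TwoLim

end Limits

section Pushouts

variable {A : Type u₀} {B : Type u₁} {C : Type u₂} {D : Type u₃}
  [Groupoid.{v₀} A] [Groupoid.{v₁} B] [Groupoid.{v₂} C] [Groupoid.{v₃} D]
  {i₁ : A ⥤ B} {i₂ : A ⥤ C} {a : A ⥤ D} {j₁ : B ⥤ D} {j₂ : C ⥤ D}

/-- The canonical functor `c` from `hom(D, T)` to the limit of `hom(A, T)`, `hom(B, T)` and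
`hom(C, T)`, given by composition with the functors `a`, `j₁` and `j₂` of a strictly commutative
square with diagonal `a`. -/
def limComparison (h₁ : i₁ ⋙ j₁ = a) (h₂ : i₂ ⋙ j₂ = a) (T : Type*) [Groupoid T] :
    (D ⥤ T) ⥤ Lim ((Functor.whiskeringLeft A B T).obj i₁)
      ((Functor.whiskeringLeft A C T).obj i₂) where
  obj χ :=
    { base := a ⋙ χ
      fst := j₁ ⋙ χ
      snd := j₂ ⋙ χ
      fst_eq := congrArg (· ⋙ χ) h₁
      snd_eq := congrArg (· ⋙ χ) h₂ }
  map {χ χ'} θ :=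
    { base := Functor.whiskerLeft a θ
      fst := Functor.whiskerLeft j₁ θ
      snd := Functor.whiskerLeft j₂ θ
      fst_w := by subst h₁; ext; simp
      snd_w := by subst h₂; ext; simp }
  map_id _ := rfl
  map_comp _ _ := rfl

/-- The canonical functor `κ` from `hom(D, T)` to the 2-limit of `hom(A, T)`, `hom(B, T)` and
`hom(C, T)`, given by composition with the functors `a`, `j₁`, `j₂` and the natural isomorphisms
`l₁`, `l₂` of a 2-commutative square with diagonal `a`. -/
def twoLimComparison (l₁ : i₁ ⋙ j₁ ≅ a) (l₂ : i₂ ⋙ j₂ ≅ a) (T : Type*) [Groupoid T] :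
    (D ⥤ T) ⥤ TwoLim ((Functor.whiskeringLeft A B T).obj i₁)
      ((Functor.whiskeringLeft A C T).obj i₂) where
  obj χ :=
    { base := a ⋙ χ
      fst := j₁ ⋙ χ
      snd := j₂ ⋙ χ
      fstIso := Functor.isoWhiskerRight l₁ χ
      sndIso := Functor.isoWhiskerRight l₂ χ }
  map {χ χ'} θ :=
    { base := Functor.whiskerLeft a θ
      fst := Functor.whiskerLeft j₁ θ
      snd := Functor.whiskerLeft j₂ θ
      fst_w := by ext; simp
      snd_w := by ext; simp }
  map_id _ := rfl
  map_comp _ _ := rfl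

/-- A strictly commutative square of groupoids with diagonal `a` is a pushout of groupoids, i.e.
`D` is the colimit of `B ⟵ A ⟶ C`: for every groupoid `T` the canonical functor from `hom(D, T)`
to the limit of `hom(A, T)`, `hom(B, T)`, `hom(C, T)` is an isomorphism of categories. -/
def IsGroupoidPushout.{v, w, v₀', v₁', v₂', v₃', u₀', u₁', u₂', u₃'}
    {A : Type u₀'} {B : Type u₁'} {C : Type u₂'} {D : Type u₃'}
    [Groupoid.{v₀'} A] [Groupoid.{v₁'} B] [Groupoid.{v₂'} C] [Groupoid.{v₃'} D]
    {i₁ : A ⥤ B} {i₂ : A ⥤ C} {a : A ⥤ D} {j₁ : B ⥤ D} {j₂ : C ⥤ D}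
    (h₁ : i₁ ⋙ j₁ = a) (h₂ : i₂ ⋙ j₂ = a) : Prop :=
  ∀ (T : Type w) [Groupoid.{v} T], (limComparison h₁ h₂ T).IsIso

/-- A 2-commutative square of groupoids with diagonal `a` is a 2-pushout of groupoids, i.e. `D` is
the 2-colimit of `B ⟵ A ⟶ C`: for every groupoid `T` the canonical functor from `hom(D, T)` to
the 2-limit of `hom(A, T)`, `hom(B, T)`, `hom(C, T)` is an equivalence of categories. -/
def IsGroupoidTwoPushout.{v, w, v₀', v₁', v₂', v₃', u₀', u₁', u₂', u₃'}
    {A : Type u₀'} {B : Type u₁'} {C : Type u₂'} {D : Type u₃'}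
    [Groupoid.{v₀'} A] [Groupoid.{v₁'} B] [Groupoid.{v₂'} C] [Groupoid.{v₃'} D]
    {i₁ : A ⥤ B} {i₂ : A ⥤ C} {a : A ⥤ D} {j₁ : B ⥤ D} {j₂ : C ⥤ D}
    (l₁ : i₁ ⋙ j₁ ≅ a) (l₂ : i₂ ⋙ j₂ ≅ a) : Prop :=
  ∀ (T : Type w) [Groupoid.{v} T], (twoLimComparison l₁ l₂ T).IsEquivalence

end Pushouts

section FundamentalGroupoids

variable {X : Type u₀} [TopologicalSpace X]

/-- The inclusion of a subspace, as a continuous map. -/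
def incl (S : Set X) : C(S, X) := ⟨Subtype.val, continuous_subtype_val⟩

/-- The functor `Π₁(S) ⥤ Π₁(S')` induced by an inclusion `S ⊆ S'` of subspaces of `X`. -/
abbrev piMap {S S' : Set X} (h : S ⊆ S') : FundamentalGroupoid S ⥤ FundamentalGroupoid S' :=
  FundamentalGroupoid.map (ContinuousMap.inclusion h)

/-- The functor `Π₁(S) ⥤ Π₁(X)` induced by the inclusion of a subspace `S` of `X`. -/
abbrev piIncl (S : Set X) : FundamentalGroupoid S ⥤ FundamentalGroupoid X :=
  FundamentalGroupoid.map (incl S)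

theorem piMap_comp_piIncl {S S' : Set X} (h : S ⊆ S') : piMap h ⋙ piIncl S' = piIncl S :=
  (FundamentalGroupoid.map_comp (incl S') (ContinuousMap.inclusion h)).symm

end FundamentalGroupoids

end VanKampen

universe v w u

/-! A functor on the fundamental groupoid is a homotopy invariant parallel transport, and transport
can be tested locally. Given compatible functors on the members of an open cover, short paths have a
prescribed transport (`PathTransport`). For an arbitrary path, a family of morphisms over the points
of `[0, 1]` that is compatible with all short segments (`ParallelOn`) exists and is determined by
its initial value: a partition subordinate to the cover gives both (`exists_parallelOn`,
`parallelOn_unique`). The definition mentions no partition, so no common refinements are needed;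
multiplicativity follows from uniqueness (`IsTransport.trans`).

Homotopy invariance (`IsTransport.eq_of_homotopy`) comes from a grid on the square each of whose
cells maps into one member: going around a cell either way gives the same morphism, and these
squares paste. This glues functors. Functors and transformations are determined by their
restrictions, and transformations glue, because short paths generate the groupoid
(`morphismProperty_of_cover`).

The 2-pushout needs one more fact: `Π₁(W) → Π₁(U)` is injective on objects, so a functor on `Π₁(U)`
whose restriction is only isomorphic to `x_W` can be replaced by an isomorphic one restricting
exactly to `x_W` (`exists_iso_restrict_eq`). Every object of the 2-limit is thus isomorphic to a
strict one. -/

section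

open Set Topology
open scoped unitInterval

/-! ### Local transport data and convex pieces -/

/-- Local data for a functor on the fundamental groupoid of `X`, relative to a family `c` of
subsets of `X`: a morphism for each path which lies in a member of the family, compatible with
concatenation of paths and with homotopies in a member of the family. -/
structure PathTransport {ι X : Type*} [TopologicalSpace X] (c : ι → Set X) (T : Type*)
    [Category* T] where
  /-- the object attached to a point -/
  obj : X → T
  /-- the morphism attached to a path in a member of the family -/
  map : ∀ (i : ι) {x y : X} (γ : Path x y), (∀ t, γ t ∈ c i) → (obj x ⟶ obj y)
  map_refl : ∀ (i : ι) (x : X) (h : ∀ t, Path.refl x t ∈ c i), map i (Path.refl x) h = 𝟙 (obj x)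
  map_trans : ∀ (i : ι) {x y z : X} (γ : Path x y) (γ' : Path y z) (h : ∀ t, γ t ∈ c i)
    (h' : ∀ t, γ' t ∈ c i) (h'' : ∀ t, γ.trans γ' t ∈ c i),
    map i (γ.trans γ') h'' = map i γ h ≫ map i γ' h'
  map_homotopy : ∀ (i : ι) {x y : X} {γ γ' : Path x y} (H : γ.Homotopy γ') (_ : ∀ p, H p ∈ c i)
    (h : ∀ t, γ t ∈ c i) (h' : ∀ t, γ' t ∈ c i), map i γ h = map i γ' h'
  map_agree : ∀ (i j : ι) {x y : X} (γ : Path x y) (h : ∀ t, γ t ∈ c i) (h' : ∀ t, γ t ∈ c j),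
    map i γ h = map j γ h'

theorem Path.trans_mem {X : Type*} [TopologicalSpace X] {s : Set X} {x y z : X} {γ : Path x y}
    {γ' : Path y z} (h : ∀ t, γ t ∈ s) (h' : ∀ t, γ' t ∈ s) (t : I) : γ.trans γ' t ∈ s := by
  rw [Path.trans_apply]
  split_ifs
  exacts [h _, h' _]

/-- The straight line homotopy between two paths in a real topological vector space. -/
def Path.Homotopy.straight {E : Type*} [AddCommGroup E] [Module ℝ E] [TopologicalSpace E]
    [IsTopologicalAddGroup E] [ContinuousSMul ℝ E] {p q : E} (δ δ' : Path p q) :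
    δ.Homotopy δ' where
  toHomotopy := ContinuousMap.Homotopy.affine δ.toContinuousMap δ'.toContinuousMap
  prop' t u hu := by
    rcases hu with rfl | rfl <;> simp [AffineMap.lineMap_apply]

namespace PathTransport

variable {ι X : Type*} [TopologicalSpace X] {c : ι → Set X} {T : Type*} [Category* T]
  (L : PathTransport c T)

section Convex

variable {E : Type*} [AddCommGroup E] [Module ℝ E] [TopologicalSpace E]
    [IsTopologicalAddGroup E] [ContinuousSMul ℝ E]

/-- The straight line homotopy from `δ` to `δ'` stays in `B`, so its image under `f` stays in `c i`.
The paths are tied to `f` by pointwise equations, which leaves their end points free to be only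
propositionally equal to values of `f`. -/
theorem map_eq_of_convex {i : ι} (f : C(E, X)) {B : Set E} (hB : Convex ℝ B)
    (hf : ∀ b ∈ B, f b ∈ c i) {p q : E} (δ δ' : Path p q) (hδ : ∀ t, δ t ∈ B)
    (hδ' : ∀ t, δ' t ∈ B) {x y : X} {γ γ' : Path x y} (hγ : ∀ t, γ t = f (δ t))
    (hγ' : ∀ t, γ' t = f (δ' t)) (h : ∀ t, γ t ∈ c i) (h' : ∀ t, γ' t ∈ c i) :
    L.map i γ h = L.map i γ' h' := by
  obtain rfl : x = f p := by simpa using hγ 0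
  obtain rfl : y = f q := by simpa using hγ 1
  obtain rfl : γ = δ.map f.continuous := by ext t; exact hγ t
  obtain rfl : γ' = δ'.map f.continuous := by ext t; exact hγ' t
  refine L.map_homotopy i ((Path.Homotopy.straight δ δ').map f) (fun p => hf _ ?_) _ _
  exact hB.lineMap_mem (hδ _) (hδ' _) p.1.2

theorem map_segment_trans {i : ι} (f : C(E, X)) {B : Set E} (hB : Convex ℝ B)
    (hf : ∀ b ∈ B, f b ∈ c i) {p q r : E} (hp : p ∈ B) (hq : q ∈ B) (hr : r ∈ B) {x y z : X}
    {γ : Path x y} {γ' : Path y z} {γ'' : Path x z}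
    (hγ : ∀ t : I, γ t = f (AffineMap.lineMap p q (t : ℝ)))
    (hγ' : ∀ t : I, γ' t = f (AffineMap.lineMap q r (t : ℝ)))
    (hγ'' : ∀ t : I, γ'' t = f (AffineMap.lineMap p r (t : ℝ))) (h : ∀ t, γ t ∈ c i)
    (h' : ∀ t, γ' t ∈ c i) (h'' : ∀ t, γ'' t ∈ c i) :
    L.map i γ h ≫ L.map i γ' h' = L.map i γ'' h'' := by
  rw [← L.map_trans i γ γ' h h' (Path.trans_mem h h')]
  refine L.map_eq_of_convex f hB hf ((Path.segment p q).trans (Path.segment q r))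
    (Path.segment p r) (Path.trans_mem (fun t => ?_) (fun t => ?_)) (fun t => ?_) (fun t => ?_)
    hγ'' _ _
  · exact hB.lineMap_mem hp hq t.2
  · exact hB.lineMap_mem hq hr t.2
  · exact hB.lineMap_mem hp hr t.2
  · simp only [Path.trans_apply]
    split_ifs
    exacts [hγ _, hγ' _]

/-- Both composites equal the transport along the diagonal from `p` to `r`. -/
theorem map_segment_square {i : ι} (f : C(E, X)) {B : Set E} (hB : Convex ℝ B)
    (hf : ∀ b ∈ B, f b ∈ c i) {p q q' r : E} (hp : p ∈ B) (hq : q ∈ B) (hq' : q' ∈ B)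
    (hr : r ∈ B) {x y y' z : X} {γ : Path x y} {γ₁ : Path y z} {γ' : Path x y'} {γ₁' : Path y' z}
    (hγ : ∀ t : I, γ t = f (AffineMap.lineMap p q (t : ℝ)))
    (hγ₁ : ∀ t : I, γ₁ t = f (AffineMap.lineMap q r (t : ℝ)))
    (hγ' : ∀ t : I, γ' t = f (AffineMap.lineMap p q' (t : ℝ)))
    (hγ₁' : ∀ t : I, γ₁' t = f (AffineMap.lineMap q' r (t : ℝ)))
    (h : ∀ t, γ t ∈ c i) (h₁ : ∀ t, γ₁ t ∈ c i) (h' : ∀ t, γ' t ∈ c i) (h₁' : ∀ t, γ₁' t ∈ c i) :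
    L.map i γ h ≫ L.map i γ₁ h₁ = L.map i γ' h' ≫ L.map i γ₁' h₁' := by
  obtain rfl : x = f p := by simpa using hγ 0
  obtain rfl : z = f r := by simpa using hγ₁ 1
  have hs : ∀ t : I, (Path.segment p r).map f.continuous t = f (AffineMap.lineMap p r (t : ℝ)) :=
    fun t => rfl
  have hm : ∀ t : I, (Path.segment p r).map f.continuous t ∈ c i :=
    fun t => hf _ (hB.lineMap_mem hp hr t.2)
  rw [L.map_segment_trans f hB hf hp hq hr hγ hγ₁ hs h h₁ hm,
    L.map_segment_trans f hB hf hp hq' hr hγ' hγ₁' hs h' h₁' hm]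

end Convex

/-! ### Parallel families along a curve -/

/-- A compatible family of morphisms from `A` to the objects attached to the points of the curve
`f` with parameter in `S`. -/
structure ParallelOn (f : ℝ → X) (S : Set ℝ) (A : T) where
  /-- the morphism to the object attached to the point `f t` -/
  val : ∀ t ∈ S, ∀ z, f t = z → (A ⟶ L.obj z)
  -- The points are variables subject to `f s = z` and `f t = z'`, so that values over `γ.extend 0`
  -- and over `x` can be compared without casts. All `i` are admitted, which makes the notion
  -- independent of any partition.
  par : ∀ (i : ι) {s t : ℝ} (hs : s ∈ S) (ht : t ∈ S) {z z' : X} (hz : f s = z) (hz' : f t = z')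
    (η : Path z z') (h : ∀ u, η u ∈ c i), s ≤ t →
    (∀ u : I, η u = f (AffineMap.lineMap s t (u : ℝ))) →
    val s hs z hz ≫ L.map i η h = val t ht z' hz'

/-- Restriction of a curve in `X` to the segment from `s` to `t`. -/
abbrev _root_.ContinuousMap.segmentPath (f : C(ℝ, X)) (s t : ℝ) : Path (f s) (f t) :=
  (Path.segment s t).map f.continuous

namespace ParallelOn

variable {L} {f : C(ℝ, X)} {A : T}

/-- Extend a parallel family from `[0, a]` to `[0, b]` when the curve stays in a member of the
family on `[a, b]`. -/
noncomputable def extend {a b : ℝ} (P : L.ParallelOn f (Icc 0 a) A) (ha : 0 ≤ a)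
    {i : ι} (hi : ∀ t ∈ Icc a b, f t ∈ c i) : L.ParallelOn f (Icc 0 b) A where
  val t ht z hz :=
    if h : t ≤ a then P.val t ⟨ht.1, h⟩ z hz
    else P.val a ⟨ha, le_rfl⟩ (f a) rfl ≫ L.map i ((f.segmentPath a t).cast rfl hz.symm)
      (fun u => hi _ ((convex_Icc a b).lineMap_mem ⟨le_rfl, by linarith [ht.2]⟩
        ⟨by linarith, ht.2⟩ u.2))
  par j s t hs ht z z' hz hz' η h hst hη := by
    subst hz hz'
    have key : ∀ u ∈ Icc s t, f u ∈ c j := fun u hu => by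
      rw [← segment_eq_Icc hst, segment_eq_image_lineMap] at hu
      obtain ⟨r, hr, rfl⟩ := hu
      simpa [hη] using h ⟨r, hr⟩
    by_cases hta : t ≤ a
    · have hsa : s ≤ a := hst.trans hta
      simp only [hta, hsa, dif_pos]
      exact P.par j _ _ rfl rfl η h hst hη
    by_cases hsa : s ≤ a
    · have hat : a ≤ t := by linarith
      simp only [hta, hsa, dif_pos, dif_neg, not_false_iff, Path.cast_rfl_rfl]
      have h1 : ∀ u, f.segmentPath s a u ∈ c j := fun u => key _
        ((convex_Icc s t).lineMap_mem ⟨le_rfl, hst⟩ ⟨hsa, hat⟩ u.2)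
      have h2 : ∀ u, f.segmentPath a t u ∈ c j := fun u => key _
        ((convex_Icc s t).lineMap_mem ⟨hsa, hat⟩ ⟨hst, le_rfl⟩ u.2)
      -- The segment from `a` to `t` lies in both `c i` and `c j`; it is moved to `c j`, which
      -- contains the curve on all of `[s, t]`.
      rw [L.map_agree i j _ _ h2,
        ← P.par j ⟨hs.1, hsa⟩ ⟨ha, le_rfl⟩ rfl rfl (f.segmentPath s a) h1 hsa (fun _ => rfl),
        Category.assoc]
      congr 1
      symm
      exact L.map_segment_trans f (convex_Icc s t) key ⟨le_rfl, hst⟩ ⟨hsa, hat⟩ ⟨hst, le_rfl⟩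
        (fun _ => rfl) (fun _ => rfl) hη _ _ _
    · have hsa' : a ≤ s := by linarith
      have hta' : a ≤ t := by linarith
      -- Here the move goes the other way: `c j` need not contain the curve between `a` and `s`,
      -- while `c i` contains it on `[a, b]`.
      have hsub : ∀ u, η u ∈ c i := fun u => by
        rw [hη]
        exact hi _ ((convex_Icc a b).lineMap_mem ⟨hsa', hs.2⟩ ⟨hta', ht.2⟩ u.2)
      simp only [hta, hsa, dif_neg, not_false_iff, Category.assoc, Path.cast_rfl_rfl]
      congr 1
      rw [L.map_agree j i η h hsub]
      exact L.map_segment_trans f (convex_Icc a b) hi ⟨le_rfl, hta'.trans ht.2⟩ ⟨hsa', hs.2⟩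
        ⟨hta', ht.2⟩ (fun _ => rfl) hη (fun _ => rfl) _ _ _

theorem extend_val {a b : ℝ} (P : L.ParallelOn f (Icc 0 a) A) (ha : 0 ≤ a)
    {i : ι} (hi : ∀ t ∈ Icc a b, f t ∈ c i) {t : ℝ} (ht : t ∈ Icc 0 b) (hta : t ≤ a) (z : X)
    (hz : f t = z) : (P.extend ha hi).val t ht z hz = P.val t ⟨ht.1, hta⟩ z hz :=
  dif_pos hta

/-- The parallel family on a single point of the curve given by a morphism. -/
def single (φ : A ⟶ L.obj (f 0)) : L.ParallelOn f (Icc 0 0) A where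
  val t ht z hz := φ ≫ eqToHom (by rw [← hz, le_antisymm ht.2 ht.1])
  par i s t hs ht z z' hz hz' η h hst hη := by
    obtain rfl := le_antisymm hs.2 hs.1
    obtain rfl := le_antisymm ht.2 ht.1
    subst hz hz'
    obtain rfl : η = Path.refl _ := by ext u; simpa using hη u
    simp [L.map_refl]

theorem single_val (φ : A ⟶ L.obj (f 0)) (h : (0 : ℝ) ∈ Icc (0 : ℝ) 0) :
    (single φ : L.ParallelOn f (Icc 0 0) A).val 0 h (f 0) rfl = φ := by
  simp [single]

end ParallelOn

/-- A partition of the unit interval which is subordinate to an open cover. -/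
theorem exists_partition (hc : ⋃ i, c i = univ) (ho : ∀ i, IsOpen (c i)) (f : C(ℝ, X)) :
    ∃ t : ℕ → ℝ, t 0 = 0 ∧ Monotone t ∧ (∃ n, t n = 1) ∧ ∀ n, t n ∈ Icc (0 : ℝ) 1 ∧
      ∃ i, ∀ s ∈ Icc (t n) (t (n + 1)), f s ∈ c i := by
  obtain ⟨t, h0, hm, ⟨n, hn⟩, h⟩ := exists_monotone_Icc_subset_open_cover_unitInterval
    (c := fun i => {s : I | f s ∈ c i})
    (fun i => (ho i).preimage (f.continuous.comp continuous_subtype_val))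
    (fun s _ => mem_iUnion.2 (iUnion_eq_univ_iff.1 hc (f s)))
  refine ⟨fun n => t n, by simp [h0], fun _ _ hab => hm hab, ⟨n, by simp [hn n le_rfl]⟩,
    fun n => ⟨(t n).2, ?_⟩⟩
  obtain ⟨i, hi⟩ := h n
  refine ⟨i, fun s hs => ?_⟩
  have hs' : s ∈ I := ⟨(t n).2.1.trans hs.1, hs.2.trans (t (n + 1)).2.2⟩
  exact hi (show (⟨s, hs'⟩ : I) ∈ Icc (t n) (t (n + 1)) from hs)

theorem exists_parallelOn (hc : ⋃ i, c i = univ) (ho : ∀ i, IsOpen (c i)) (f : C(ℝ, X)) {A : T}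
    (φ : A ⟶ L.obj (f 0)) :
    ∃ P : L.ParallelOn f (Icc 0 1) A, P.val 0 ⟨le_rfl, zero_le_one⟩ (f 0) rfl = φ := by
  obtain ⟨t, h0, hm, ⟨n, hn⟩, h⟩ := exists_partition hc ho f
  -- The type of `P` depends on the end point, so this is a variable `b` with `b = t n`; at the end
  -- `b` is literally `1`.
  suffices H : ∀ n b (_ : b = t n) (hb : b ∈ Icc (0 : ℝ) 1), ∃ P : L.ParallelOn f (Icc 0 b) A,
      P.val 0 ⟨le_rfl, hb.1⟩ (f 0) rfl = φ from H n 1 hn.symm ⟨zero_le_one, le_rfl⟩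
  intro n
  induction n with
  | zero => rw [h0]; rintro b rfl hb; exact ⟨.single φ, ParallelOn.single_val φ _⟩
  | succ n ih =>
    rintro b rfl hb
    obtain ⟨P, hP⟩ := ih _ rfl (h n).1
    obtain ⟨i, hi⟩ := (h n).2
    exact ⟨P.extend (h n).1.1 hi, (P.extend_val _ _ _ (h n).1.1 _ _).trans hP⟩

/-- On each interval of a partition, `par` determines the value at the right end from the one at the
left end. The morphism `φ` between the sources allows a family started at an intermediate point to
be compared with one started earlier. -/
theorem parallelOn_unique (hc : ⋃ i, c i = univ) (ho : ∀ i, IsOpen (c i)) {f : C(ℝ, X)} {A B : T}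
    (P : L.ParallelOn f (Icc 0 1) A) (Q : L.ParallelOn f (Icc 0 1) B) (φ : B ⟶ A)
    {x y : X} (hx : f 0 = x) (hy : f 1 = y) (h₀ : φ ≫ P.val 0 ⟨le_rfl, zero_le_one⟩ x hx =
      Q.val 0 ⟨le_rfl, zero_le_one⟩ x hx) :
    φ ≫ P.val 1 ⟨zero_le_one, le_rfl⟩ y hy = Q.val 1 ⟨zero_le_one, le_rfl⟩ y hy := by
  obtain ⟨t, h0, hm, ⟨n, hn⟩, h⟩ := exists_partition hc ho f
  subst hx hy
  suffices H : ∀ n s (hs : s = t n) (h : s ∈ Icc (0 : ℝ) 1),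
      φ ≫ P.val s h (f s) rfl = Q.val s h (f s) rfl from H n 1 hn.symm _
  intro n
  induction n with
  | zero => rw [h0]; rintro s rfl hs; exact h₀
  | succ n ih =>
    rintro s rfl hs
    obtain ⟨i, hi⟩ := (h n).2
    have hle := hm n.le_succ
    have hη : ∀ u, f.segmentPath (t n) (t (n + 1)) u ∈ c i := fun u =>
      hi _ ((convex_Icc _ _).lineMap_mem ⟨le_rfl, hle⟩ ⟨hle, le_rfl⟩ u.2)
    rw [← P.par i (h n).1 hs rfl rfl _ hη hle (fun _ => rfl),
      ← Q.par i (h n).1 hs rfl rfl _ hη hle (fun _ => rfl), ← Category.assoc, ih _ rfl (h n).1]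

/-- Pull back a parallel family along an affine change of the parameter. -/
def ParallelOn.reparam {L : PathTransport c T} {f f' : ℝ → X} {A : T} {S S' : Set ℝ}
    (P : L.ParallelOn f S A) (g : ℝ →ᵃ[ℝ] ℝ) (hg : Monotone g) (hS : ∀ t ∈ S', g t ∈ S)
    (hf : ∀ t ∈ S', f' t = f (g t)) (hS' : Convex ℝ S') : L.ParallelOn f' S' A where
  val t ht z hz := P.val (g t) (hS t ht) z ((hf t ht).symm.trans hz)
  par i s t hs ht z z' hz hz' η h hst hη := by
    refine P.par i _ _ _ _ η h (hg hst) fun u => ?_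
    rw [hη, hf _ (hS'.lineMap_mem hs ht u.2), AffineMap.apply_lineMap]

/-! ### Transport along a path and concatenation -/

/-- The morphism `φ` arises by parallel transport along the path `γ`. -/
def IsTransport {x y : X} (γ : Path x y) (φ : L.obj x ⟶ L.obj y) : Prop :=
  ∃ P : L.ParallelOn γ.extend (Icc 0 1) (L.obj x),
    P.val 0 ⟨le_rfl, zero_le_one⟩ x γ.extend_zero = 𝟙 _ ∧
    P.val 1 ⟨zero_le_one, le_rfl⟩ y γ.extend_one = φ

variable {L}

theorem IsTransport.eq_map {x y : X} {γ : Path x y} {φ : L.obj x ⟶ L.obj y}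
    (h : L.IsTransport γ φ) (i : ι) (hi : ∀ t, γ t ∈ c i) : φ = L.map i γ hi := by
  obtain ⟨P, hP, rfl⟩ := h
  rw [← P.par i ⟨le_rfl, zero_le_one⟩ ⟨zero_le_one, le_rfl⟩ γ.extend_zero γ.extend_one γ hi
    zero_le_one (fun u => by simp [AffineMap.lineMap_apply]), hP, Category.id_comp]

theorem exists_isTransport (hc : ⋃ i, c i = univ) (ho : ∀ i, IsOpen (c i)) {x y : X}
    (γ : Path x y) : ∃ φ, L.IsTransport γ φ := by
  obtain ⟨P, hP⟩ := L.exists_parallelOn hc ho γ.extend (A := L.obj x)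
    (eqToHom (by rw [γ.extend_zero]))
  refine ⟨_, P, ?_, rfl⟩
  have key : ∀ z (hz : γ.extend 0 = z), P.val 0 ⟨le_rfl, zero_le_one⟩ z hz =
      eqToHom (by rw [← hz, γ.extend_zero]) := by
    rintro z rfl
    exact hP
  exact key x _

theorem IsTransport.unique (hc : ⋃ i, c i = univ) (ho : ∀ i, IsOpen (c i)) {x y : X}
    {γ : Path x y} {φ φ' : L.obj x ⟶ L.obj y} (h : L.IsTransport γ φ) (h' : L.IsTransport γ φ') :
    φ = φ' := by
  obtain ⟨P, hP, rfl⟩ := h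
  obtain ⟨Q, hQ, rfl⟩ := h'
  have := L.parallelOn_unique hc ho P Q (𝟙 _) γ.extend_zero γ.extend_one (by simp [hP, hQ])
  simpa using this

/-- A family `Q` along the concatenation is restricted to the two halves. Uniqueness identifies the
first half with `P`, and the second with `P'` preceded by the end value of `P`. -/
theorem IsTransport.trans (hc : ⋃ i, c i = univ) (ho : ∀ i, IsOpen (c i)) {x y z : X}
    {γ : Path x y} {γ' : Path y z} {φ : L.obj x ⟶ L.obj y} {φ' : L.obj y ⟶ L.obj z}
    (h : L.IsTransport γ φ) (h' : L.IsTransport γ' φ') :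
    L.IsTransport (γ.trans γ') (φ ≫ φ') := by
  obtain ⟨P, hP, rfl⟩ := h
  obtain ⟨P', hP', rfl⟩ := h'
  obtain ⟨_, Q, hQ, -⟩ := exists_isTransport (L := L) hc ho (γ.trans γ')
  refine ⟨Q, hQ, ?_⟩
  have hg {a b : ℝ} (hab : a ≤ b) : Monotone (AffineMap.lineMap a b : ℝ →ᵃ[ℝ] ℝ) := by
    intro s t hst
    simp only [AffineMap.lineMap_apply, vsub_eq_sub, smul_eq_mul, vadd_eq_add]
    nlinarith
  let Q₁ : L.ParallelOn γ.extend (Icc 0 1) (L.obj x) :=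
    Q.reparam (AffineMap.lineMap 0 (1 / 2)) (hg (by norm_num))
      (fun t ht => (convex_Icc (0 : ℝ) 1).lineMap_mem (by norm_num) (by norm_num) ht)
      (fun t ht => by
        rw [Path.extend_trans_of_le_half _ _ (by simp [AffineMap.lineMap_apply]; linarith [ht.2])]
        congr 1
        simp [AffineMap.lineMap_apply]; ring) (convex_Icc _ _)
  let Q₂ : L.ParallelOn γ'.extend (Icc 0 1) (L.obj x) :=
    Q.reparam (AffineMap.lineMap (1 / 2) 1) (hg (by norm_num))
      (fun t ht => (convex_Icc (0 : ℝ) 1).lineMap_mem (by norm_num) (by norm_num) ht)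
      (fun t ht => by
        rw [Path.extend_trans_of_half_le _ _ (by simp [AffineMap.lineMap_apply]; linarith [ht.1])]
        congr 1
        simp [AffineMap.lineMap_apply]; ring) (convex_Icc _ _)
  have hval : ∀ {s t : ℝ} (_ : s = t) (hs : s ∈ Icc (0 : ℝ) 1) (ht : t ∈ Icc (0 : ℝ) 1) (w : X)
      (hw : (γ.trans γ').extend s = w) (hw' : (γ.trans γ').extend t = w),
      Q.val s hs w hw = Q.val t ht w hw' := by
    rintro s _ rfl _ _ _ _ _
    rfl
  have h₁ := L.parallelOn_unique hc ho P Q₁ (𝟙 _) γ.extend_zero γ.extend_one (by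
    rw [hP, Category.id_comp, ← hQ]
    exact hval (by simp) _ _ _ _ _)
  have h₂ := L.parallelOn_unique hc ho P' Q₂ (P.val 1 ⟨zero_le_one, le_rfl⟩ y γ.extend_one)
    γ'.extend_zero γ'.extend_one (by
      rw [hP', Category.comp_id]
      exact ((Category.id_comp _).symm.trans h₁).trans (hval (by simp) _ _ _ _ _))
  rw [h₂]
  exact hval (by simp) _ _ _ _ _

/-! ### Homotopy invariance of transport -/

/-- The extension of a homotopy of paths to the plane. -/
noncomputable def _root_.Path.Homotopy.planeExtend {x y : X} {γ γ' : Path x y}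
    (H : γ.Homotopy γ') : C(ℝ × ℝ, X) where
  toFun p := H (projIcc 0 1 zero_le_one p.1, projIcc 0 1 zero_le_one p.2)
  continuous_toFun := by fun_prop

theorem IsTransport.eq_of_homotopy (hc : ⋃ i, c i = univ) (ho : ∀ i, IsOpen (c i)) {x y : X}
    {γ γ' : Path x y} (H : γ.Homotopy γ') {φ φ' : L.obj x ⟶ L.obj y}
    (h : L.IsTransport γ φ) (h' : L.IsTransport γ' φ') : φ = φ' := by
  obtain ⟨t, h0, hm, ⟨N, hN⟩, ht⟩ := exists_monotone_Icc_subset_open_cover_unitInterval_prod_self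
    (c := fun i => {p : I × I | H p ∈ c i}) (fun i => (ho i).preimage (by fun_prop))
    (fun p _ => mem_iUnion.2 (iUnion_eq_univ_iff.1 hc (H p)))
  have h0' : H.eval (t 0) = γ := by rw [h0, H.eval_zero]
  have hN' : H.eval (t N) = γ' := by rw [hN N le_rfl, H.eval_one]
  suffices key : ∀ n (φ φ' : L.obj x ⟶ L.obj y), L.IsTransport (H.eval (t n)) φ →
      L.IsTransport (H.eval (t (n + 1))) φ' → φ = φ' by
    have : ∀ n φ, L.IsTransport (H.eval (t 0)) φ → L.IsTransport (H.eval (t n)) φ := by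
      intro n
      induction n with
      | zero => exact fun _ h => h
      | succ n ih =>
        intro φ hφ
        obtain ⟨φ', h'⟩ := exists_isTransport (L := L) hc ho (H.eval (t (n + 1)))
        rwa [key n φ φ' (ih φ hφ) h']
    exact IsTransport.unique hc ho (hN' ▸ this N φ (h0'.symm ▸ h)) h'
  clear h h' φ φ'
  rintro n φ φ' ⟨P, hP, rfl⟩ ⟨Q, hQ, rfl⟩
  have hle := fun n : ℕ => hm n.le_succ
  have hF : ∀ s u : I, (H.eval s).extend u = H.planeExtend (s, u) := fun s u => by
    simp [Path.Homotopy.planeExtend, Path.Homotopy.eval]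
  -- Two adjacent rows are compared at each grid point through the short edge `η` joining them. The
  -- member containing `η` is arbitrary, since neighbouring cells may lie in different members.
  suffices hind : ∀ m u (_ : u = t m) (z z' : X) (hz : (H.eval (t n)).extend u = z)
      (hz' : (H.eval (t (n + 1))).extend u = z') i (η : Path z z') (hη : ∀ r, η r ∈ c i),
      (∀ r : I, η r = H.planeExtend (AffineMap.lineMap (((t n : I) : ℝ), (u : ℝ))
        (((t (n + 1) : I) : ℝ), (u : ℝ)) (r : ℝ))) →
      P.val u u.2 z hz ≫ L.map i η hη = Q.val u u.2 z' hz' by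
    -- At `u = 1` the connecting edge is constant, because the homotopy fixes the end points.
    obtain ⟨i, hi⟩ := iUnion_eq_univ_iff.1 hc y
    have := hind N 1 (hN N le_rfl).symm y y (by simp) (by simp) i (Path.refl y) (fun _ => hi)
      (fun r => by simp [Path.Homotopy.planeExtend, AffineMap.lineMap_apply])
    exact (((congrArg (_ ≫ ·) (L.map_refl i y _)).trans (Category.comp_id _)).symm.trans this)
  intro m
  induction m with
  | zero =>
    rintro u rfl z z' hz hz' i η hη hηf
    obtain rfl : z = x := by rw [← hz, h0]; simp
    obtain rfl : z' = z := by rw [← hz', h0]; simp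
    obtain rfl : η = Path.refl _ := by
      ext r
      rw [hηf]
      simp [Path.Homotopy.planeExtend, AffineMap.lineMap_apply, h0]
    rw [L.map_refl, Category.comp_id]
    have hP' : ∀ (s : ℝ) (_ : s = 0) (hs : s ∈ Icc (0 : ℝ) 1) hz,
      P.val s hs z' hz = 𝟙 _ := by rintro s rfl hs _; exact hP
    have hQ' : ∀ (s : ℝ) (_ : s = 0) (hs : s ∈ Icc (0 : ℝ) 1) hz,
      Q.val s hs z' hz = 𝟙 _ := by rintro s rfl hs _; exact hQ
    rw [hP' _ (by rw [h0]; rfl), hQ' _ (by rw [h0]; rfl)]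
  | succ m ih =>
    rintro u rfl z z' hz hz' j η hη hηf
    obtain ⟨i, hi⟩ := ht n m
    set B : Set (ℝ × ℝ) := Icc ((t n : I) : ℝ) (t (n + 1) : I) ×ˢ
      Icc ((t m : I) : ℝ) (t (m + 1) : I) with hB
    have hBc : Convex ℝ B := (convex_Icc _ _).prod (convex_Icc _ _)
    have hBf : ∀ b ∈ B, H.planeExtend b ∈ c i := by
      rintro ⟨a, b⟩ ⟨ha, hb⟩
      have ha' : a ∈ I := ⟨(t n).2.1.trans ha.1, ha.2.trans (t (n + 1)).2.2⟩
      have hb' : b ∈ I := ⟨(t m).2.1.trans hb.1, hb.2.trans (t (m + 1)).2.2⟩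
      have := hi (show ((⟨a, ha'⟩, ⟨b, hb'⟩) : I × I) ∈ _ from ⟨ha, hb⟩)
      simpa [Path.Homotopy.planeExtend, projIcc_of_mem _ ha', projIcc_of_mem _ hb'] using this
    have p00 : (((t n : I) : ℝ), ((t m : I) : ℝ)) ∈ B := ⟨⟨le_rfl, hle n⟩, ⟨le_rfl, hle m⟩⟩
    have p10 : (((t (n + 1) : I) : ℝ), ((t m : I) : ℝ)) ∈ B := ⟨⟨hle n, le_rfl⟩, ⟨le_rfl, hle m⟩⟩
    have p01 : (((t n : I) : ℝ), ((t (m + 1) : I) : ℝ)) ∈ B :=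
      ⟨⟨le_rfl, hle n⟩, ⟨hle m, le_rfl⟩⟩
    have p11 : (((t (n + 1) : I) : ℝ), ((t (m + 1) : I) : ℝ)) ∈ B :=
      ⟨⟨hle n, le_rfl⟩, ⟨hle m, le_rfl⟩⟩
    have row : ∀ (s : I) (a b : I) (r : I),
        (H.eval s).extend (AffineMap.lineMap (a : ℝ) (b : ℝ) (r : ℝ)) =
        H.planeExtend (AffineMap.lineMap ((s : ℝ), (a : ℝ)) ((s : ℝ), (b : ℝ)) (r : ℝ)) := by
      intro s a b r
      have hr : AffineMap.lineMap (a : ℝ) (b : ℝ) (r : ℝ) ∈ I :=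
        (convex_Icc (0 : ℝ) 1).lineMap_mem a.2 b.2 r.2
      rw [show (AffineMap.lineMap ((s : ℝ), (a : ℝ)) ((s : ℝ), (b : ℝ)) (r : ℝ) : ℝ × ℝ) =
        ((s : ℝ), AffineMap.lineMap (a : ℝ) (b : ℝ) (r : ℝ)) by
          simp [AffineMap.lineMap_apply]]
      exact hF s ⟨_, hr⟩
    subst hz hz'
    have hbot : ∀ u, (H.eval (t n)).extend.segmentPath (t m : I) (t (m + 1) : I) u ∈ c i :=
      fun u => by
        rw [show (H.eval (t n)).extend.segmentPath (t m : I) (t (m + 1) : I) u = _ from row _ _ _ u]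
        exact hBf _ (hBc.lineMap_mem p00 p01 u.2)
    have htop : ∀ u, (H.eval (t (n + 1))).extend.segmentPath (t m : I) (t (m + 1) : I) u ∈ c i :=
      fun u => by
        rw [show (H.eval (t (n + 1))).extend.segmentPath (t m : I) (t (m + 1) : I) u = _
          from row _ _ _ u]
        exact hBf _ (hBc.lineMap_mem p10 p11 u.2)
    let ξ : Path ((H.eval (t n)).extend (t m : I)) ((H.eval (t (n + 1))).extend (t m : I)) :=
      ((Path.segment (((t n : I) : ℝ), ((t m : I) : ℝ))
        (((t (n + 1) : I) : ℝ), ((t m : I) : ℝ))).map H.planeExtend.continuous).cast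
        (hF _ _) (hF _ _)
    have hξ : ∀ u, ξ u ∈ c i := fun u => hBf _ (hBc.lineMap_mem p00 p10 u.2)
    have hη' : ∀ r, η r ∈ c i := fun r => by
      rw [hηf]
      exact hBf _ (hBc.lineMap_mem p01 p11 r.2)
    -- Both families are pulled back to `t m`, where the induction hypothesis applies to the edge
    -- `ξ`. What remains is the commutativity of a single cell inside `c i`.
    rw [← P.par i (t m).2 (t (m + 1)).2 rfl rfl _ hbot (hle m) (fun _ => rfl),
      ← Q.par i (t m).2 (t (m + 1)).2 rfl rfl _ htop (hle m) (fun _ => rfl),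
      ← ih (t m) rfl _ _ rfl rfl i ξ hξ (fun _ => rfl), Category.assoc, Category.assoc,
      L.map_agree j i η hη hη']
    congr 1
    exact L.map_segment_square H.planeExtend hBc hBf p00 p01 p10 p11 (row _ _ _) hηf
      (fun _ => rfl) (row _ _ _) _ _ _ _

variable (L)

/-- The functor on the fundamental groupoid which is determined by local data relative to an
open cover. -/
noncomputable def functor (hc : ⋃ i, c i = univ) (ho : ∀ i, IsOpen (c i)) :
    FundamentalGroupoid X ⥤ T where
  obj x := L.obj x.as
  map {x y} p := Quotient.lift (s := Path.Homotopic.setoid x.as y.as) (fun γ =>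
      (exists_isTransport (L := L) hc ho γ).choose)
    (fun γ γ' h => h.elim fun H => IsTransport.eq_of_homotopy hc ho H
      (exists_isTransport hc ho γ).choose_spec (exists_isTransport hc ho γ').choose_spec) p
  map_id x := by
    obtain ⟨i, hi⟩ := iUnion_eq_univ_iff.1 hc x.as
    exact ((exists_isTransport hc ho (Path.refl x.as)).choose_spec.eq_map i (fun _ => hi)).trans
      (L.map_refl i _ _)
  map_comp := by
    rintro x y z ⟨γ⟩ ⟨γ'⟩
    exact (exists_isTransport hc ho (γ.trans γ')).choose_spec.unique hc ho
      ((exists_isTransport hc ho γ).choose_spec.trans hc ho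
        (exists_isTransport hc ho γ').choose_spec)

theorem functor_map (hc : ⋃ i, c i = univ) (ho : ∀ i, IsOpen (c i)) {x y : X} (γ : Path x y)
    (i : ι) (hi : ∀ t, γ t ∈ c i) :
    (L.functor hc ho).map (X := ⟨x⟩) (Y := ⟨y⟩) (Path.Homotopic.Quotient.mk γ) = L.map i γ hi :=
  (exists_isTransport hc ho γ).choose_spec.eq_map i hi

end PathTransport

/-! ### Generation by short paths and gluing over an open cover -/

/-- A path which lies in a subspace, as a path in the subspace. -/
def Path.codRestrict {X : Type*} [TopologicalSpace X] {x y : X} (γ : Path x y) {s : Set X}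
    (h : ∀ t, γ t ∈ s) :
    Path (⟨x, γ.source ▸ h 0⟩ : s) ⟨y, γ.target ▸ h 1⟩ where
  toFun t := ⟨γ t, h t⟩
  source' := Subtype.ext γ.source
  target' := Subtype.ext γ.target

namespace VanKampen

variable {ι : Type*} {X : Type u} [TopologicalSpace X] {c : ι → Set X}

/-- The fundamental groupoid is generated by the paths which lie in a member of a given open
cover. -/
theorem morphismProperty_of_cover (hc : ⋃ i, c i = univ) (ho : ∀ i, IsOpen (c i))
    (W : MorphismProperty (FundamentalGroupoid X)) [W.IsMultiplicative]
    (hW : ∀ i {x y : FundamentalGroupoid (c i)} (p : x ⟶ y), W ((piIncl (c i)).map p))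
    {x y : FundamentalGroupoid X} (p : x ⟶ y) : W p := by
  suffices H : ∀ {a b : X} (γ : Path a b),
      W (FundamentalGroupoid.fromPath (Path.Homotopic.Quotient.mk γ)) by
    obtain ⟨γ, rfl⟩ := Path.Homotopic.Quotient.mk_surjective p
    exact H γ
  -- The end points become `f 0` and `f 1`, which are the ones that `subpath` produces.
  rintro _ _ ⟨f, rfl, rfl⟩
  let γ : Path (f 0) (f 1) := ⟨f, rfl, rfl⟩
  obtain ⟨t, h0, hm, ⟨n, hn⟩, h⟩ := exists_monotone_Icc_subset_open_cover_unitInterval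
    (c := fun i => γ ⁻¹' (c i)) (fun i => (ho i).preimage γ.continuous)
    (fun s _ => mem_iUnion.2 (iUnion_eq_univ_iff.1 hc (γ s)))
  have key : ∀ n, W (FundamentalGroupoid.fromPath
      (Path.Homotopic.Quotient.mk (γ.subpath 0 (t n)))) := by
    intro n
    induction n with
    | zero =>
      rw [h0, Path.subpath_self]
      exact W.id_mem _
    | succ n ih =>
      obtain ⟨i, hi⟩ := h n
      have hγ : ∀ u, γ.subpath (t n) (t (n + 1)) u ∈ c i := by
        intro u
        have : γ.subpath (t n) (t (n + 1)) u ∈ range (γ.subpath (t n) (t (n + 1))) := ⟨u, rfl⟩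
        rw [Path.range_subpath_of_le _ _ _ (hm n.le_succ)] at this
        obtain ⟨s, hs, hs'⟩ := this
        exact hs' ▸ hi hs
      have h1 := hW i (FundamentalGroupoid.fromPath
        (Path.Homotopic.Quotient.mk ((γ.subpath (t n) (t (n + 1))).codRestrict hγ)))
      have h2 := W.comp_mem _ _ ih h1
      have h3 := Path.Homotopic.Quotient.eq.2
        ⟨Path.Homotopy.subpathTransSubpath γ 0 (t n) (t (n + 1))⟩
      rw [← h3]
      exact h2
  have := key n
  rw [hn n le_rfl, Path.subpath_zero_one] at this
  exact this

variable {T : Type*} [Category* T]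

theorem functor_ext_of_cover (hc : ⋃ i, c i = univ) (ho : ∀ i, IsOpen (c i))
    {F F' : FundamentalGroupoid X ⥤ T} (h : ∀ i, piIncl (c i) ⋙ F = piIncl (c i) ⋙ F') :
    F = F' := by
  have hobj : ∀ x, F.obj x = F'.obj x := by
    rintro ⟨x⟩
    obtain ⟨i, hi⟩ := iUnion_eq_univ_iff.1 hc x
    exact Functor.congr_obj (h i) ⟨⟨x, hi⟩⟩
  let W : MorphismProperty (FundamentalGroupoid X) := fun x y f =>
    F.map f = eqToHom (hobj x) ≫ F'.map f ≫ eqToHom (hobj y).symm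
  have : W.IsMultiplicative :=
    { id_mem := fun x => by simp [W]
      comp_mem := fun f g hf hg => by
        simp only [W] at hf hg ⊢
        simp [hf, hg] }
  refine CategoryTheory.Functor.ext hobj fun x y f => ?_
  exact morphismProperty_of_cover hc ho W (fun i x y p => Functor.congr_hom (h i) p) f

theorem natTrans_ext_of_cover (hc : ⋃ i, c i = univ) {F F' : FundamentalGroupoid X ⥤ T}
    {α β : F ⟶ F'}
    (h : ∀ i, Functor.whiskerLeft (piIncl (c i)) α = Functor.whiskerLeft (piIncl (c i)) β) :
    α = β := by
  ext ⟨x⟩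
  obtain ⟨i, hi⟩ := iUnion_eq_univ_iff.1 hc x
  exact NatTrans.congr_app (h i) ⟨⟨x, hi⟩⟩

/-- The component at a point may be taken from any member containing it. Naturality squares compose,
so naturality has to be checked on short paths only. -/
theorem exists_natTrans_of_cover (hc : ⋃ i, c i = univ) (ho : ∀ i, IsOpen (c i))
    {F F' : FundamentalGroupoid X ⥤ T} (α : ∀ i, piIncl (c i) ⋙ F ⟶ piIncl (c i) ⋙ F')
    (hα : ∀ i j x (hi : x ∈ c i) (hj : x ∈ c j),
      ((α i).app ⟨⟨x, hi⟩⟩ : F.obj ⟨x⟩ ⟶ F'.obj ⟨x⟩) = (α j).app ⟨⟨x, hj⟩⟩) :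
    ∃ β : F ⟶ F', ∀ i, Functor.whiskerLeft (piIncl (c i)) β = α i := by
  choose k hk using iUnion_eq_univ_iff.1 hc
  let app : ∀ x, F.obj x ⟶ F'.obj x := fun x => (α (k x.as)).app ⟨⟨x.as, hk x.as⟩⟩
  have happ : ∀ i (x : FundamentalGroupoid (c i)), app ((piIncl (c i)).obj x) = (α i).app x :=
    fun i x => hα _ _ _ _ _
  let W : MorphismProperty (FundamentalGroupoid X) := fun x y f =>
    F.map f ≫ app y = app x ≫ F'.map f
  have : W.IsMultiplicative :=
    { id_mem := fun x => by simp [W]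
      comp_mem := fun f g hf hg => by
        simp only [W] at hf hg ⊢
        rw [F.map_comp, F'.map_comp, Category.assoc, hg, reassoc_of% hf] }
  refine ⟨{ app := app, naturality := fun x y f => ?_ }, fun i => ?_⟩
  · refine morphismProperty_of_cover hc ho W (fun i x y p => ?_) f
    simp only [W, happ]
    exact (α i).naturality p
  · ext x
    exact happ i x

theorem obj_eq_of_compatible (G : ∀ i, FundamentalGroupoid (c i) ⥤ T)
    (hG : ∀ i j, piMap (inter_subset_left : c i ∩ c j ⊆ c i) ⋙ G i =
      piMap (inter_subset_right : c i ∩ c j ⊆ c j) ⋙ G j)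
    {i j : ι} {x : X} (hi : x ∈ c i) (hj : x ∈ c j) :
    (G i).obj ⟨⟨x, hi⟩⟩ = (G j).obj ⟨⟨x, hj⟩⟩ :=
  Functor.congr_obj (hG i j) ⟨⟨x, hi, hj⟩⟩

/-- The local data given by a compatible family of functors on the fundamental groupoids of the
members of a cover. -/
noncomputable def pathTransport (hc : ⋃ i, c i = univ) (G : ∀ i, FundamentalGroupoid (c i) ⥤ T)
    (hG : ∀ i j, piMap (inter_subset_left : c i ∩ c j ⊆ c i) ⋙ G i =
      piMap (inter_subset_right : c i ∩ c j ⊆ c j) ⋙ G j) : PathTransport c T where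
  obj x := (G _).obj ⟨⟨x, (iUnion_eq_univ_iff.1 hc x).choose_spec⟩⟩
  -- The functor `G i` gives a morphism between its own values, whereas the objects come from
  -- members chosen at `x` and `y`; the outer factors identify the two.
  map i x y γ h := eqToHom (obj_eq_of_compatible G hG _ _) ≫
    (G i).map (FundamentalGroupoid.fromPath (Path.Homotopic.Quotient.mk (γ.codRestrict h))) ≫
    eqToHom (obj_eq_of_compatible G hG _ _)
  map_refl i x h := by
    have : (G i).map (FundamentalGroupoid.fromPath (Path.Homotopic.Quotient.mk
      ((Path.refl x).codRestrict h))) = 𝟙 _ := (G i).map_id _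
    rw [this]
    simp
  map_trans i x y z γ γ' h h' h'' := by
    have : (γ.trans γ').codRestrict h'' = (γ.codRestrict h).trans (γ'.codRestrict h') := by
      ext t
      simp only [Path.codRestrict, Path.trans_apply, Path.coe_mk_mk]
      split_ifs <;> rfl
    have : (G i).map (FundamentalGroupoid.fromPath (Path.Homotopic.Quotient.mk
        ((γ.trans γ').codRestrict h''))) =
      (G i).map (FundamentalGroupoid.fromPath (Path.Homotopic.Quotient.mk (γ.codRestrict h))) ≫
      (G i).map (FundamentalGroupoid.fromPath
        (Path.Homotopic.Quotient.mk (γ'.codRestrict h'))) := by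
      rw [this, ← Functor.map_comp]
      rfl
    rw [this]
    simp
  map_homotopy i x y γ γ' H hH h h' := by
    have : (γ.codRestrict h).Homotopic (γ'.codRestrict h') :=
      ⟨{ toFun := fun p => ⟨H p, hH p⟩
         map_zero_left := fun t => Subtype.ext (H.map_zero_left t)
         map_one_left := fun t => Subtype.ext (H.map_one_left t)
         prop' := fun s t ht => Subtype.ext (H.prop' s t ht) }⟩
    rw [Path.Homotopic.Quotient.eq.2 this]
  map_agree i j x y γ h h' := by
    have := Functor.congr_hom (hG i j) (FundamentalGroupoid.fromPath
      (Path.Homotopic.Quotient.mk (γ.codRestrict (s := c i ∩ c j) fun t => ⟨h t, h' t⟩)))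
    have : (G i).map (FundamentalGroupoid.fromPath (Path.Homotopic.Quotient.mk
        (γ.codRestrict h))) = eqToHom (obj_eq_of_compatible G hG _ _) ≫
      (G j).map (FundamentalGroupoid.fromPath (Path.Homotopic.Quotient.mk (γ.codRestrict h'))) ≫
      eqToHom (obj_eq_of_compatible G hG _ _) := this
    rw [this]
    simp

/-- **Van Kampen's theorem** for open covers: compatible functors on the fundamental groupoids of
the members of an open cover glue. -/
theorem exists_functor_of_cover (hc : ⋃ i, c i = univ) (ho : ∀ i, IsOpen (c i))
    (G : ∀ i, FundamentalGroupoid (c i) ⥤ T)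
    (hG : ∀ i j, piMap (inter_subset_left : c i ∩ c j ⊆ c i) ⋙ G i =
      piMap (inter_subset_right : c i ∩ c j ⊆ c j) ⋙ G j) :
    ∃ F : FundamentalGroupoid X ⥤ T, ∀ i, piIncl (c i) ⋙ F = G i := by
  refine ⟨(pathTransport hc G hG).functor hc ho, fun i => ?_⟩
  refine CategoryTheory.Functor.ext (fun x => obj_eq_of_compatible G hG _ _) fun x y p => ?_
  obtain ⟨δ, rfl⟩ := Path.Homotopic.Quotient.mk_surjective p
  exact (pathTransport hc G hG).functor_map hc ho (δ.map continuous_subtype_val) i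
    (fun t => (δ t).2)

theorem iUnion_bool_eq_univ {X : Type*} {U V : Set X} (hUV : U ∪ V = univ) : ⋃ b, Bool.rec U V b = univ := by
  rw [← hUV]
  ext x
  simp

/-! ### Covers by two open sets -/

section TwoSets

variable {X : Type u} [TopologicalSpace X] {U V : Set X}

theorem isOpen_bool (hU : IsOpen U) (hV : IsOpen V) (b : Bool) : IsOpen (Bool.rec U V b : Set X) :=
  by cases b <;> assumption

variable {T : Type*} [Category* T]

theorem functor_ext_of_union (hU : IsOpen U) (hV : IsOpen V) (hUV : U ∪ V = univ)
    {F F' : FundamentalGroupoid X ⥤ T} (h₁ : piIncl U ⋙ F = piIncl U ⋙ F')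
    (h₂ : piIncl V ⋙ F = piIncl V ⋙ F') : F = F' :=
  functor_ext_of_cover (iUnion_bool_eq_univ hUV) (isOpen_bool hU hV)
    (fun b => by cases b <;> assumption)

theorem natTrans_ext_of_union (hUV : U ∪ V = univ)
    {F F' : FundamentalGroupoid X ⥤ T} {α β : F ⟶ F'}
    (h₁ : Functor.whiskerLeft (piIncl U) α = Functor.whiskerLeft (piIncl U) β)
    (h₂ : Functor.whiskerLeft (piIncl V) α = Functor.whiskerLeft (piIncl V) β) : α = β :=
  natTrans_ext_of_cover (iUnion_bool_eq_univ hUV) (fun b => by cases b <;> assumption)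

theorem exists_natTrans_of_union (hU : IsOpen U) (hV : IsOpen V) (hUV : U ∪ V = univ)
    {F F' : FundamentalGroupoid X ⥤ T} (α : piIncl U ⋙ F ⟶ piIncl U ⋙ F')
    (β : piIncl V ⋙ F ⟶ piIncl V ⋙ F')
    (h : ∀ x (hi : x ∈ U) (hj : x ∈ V),
      (α.app ⟨⟨x, hi⟩⟩ : F.obj ⟨x⟩ ⟶ F'.obj ⟨x⟩) = β.app ⟨⟨x, hj⟩⟩) :
    ∃ θ : F ⟶ F', Functor.whiskerLeft (piIncl U) θ = α ∧
      Functor.whiskerLeft (piIncl V) θ = β := by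
  obtain ⟨θ, hθ⟩ := exists_natTrans_of_cover (iUnion_bool_eq_univ hUV) (isOpen_bool hU hV)
    (fun b => by cases b; exacts [α, β]) (F := F) (F' := F') (by
      rintro (_ | _) (_ | _) x hi hj
      exacts [rfl, h x hi hj, (h x hj hi).symm, rfl])
  exact ⟨θ, hθ false, hθ true⟩

theorem exists_functor_of_union (hU : IsOpen U) (hV : IsOpen V) (hUV : U ∪ V = univ)
    (F : FundamentalGroupoid U ⥤ T) (G : FundamentalGroupoid V ⥤ T)
    (h : piMap (inter_subset_left : U ∩ V ⊆ U) ⋙ F = piMap (inter_subset_right : U ∩ V ⊆ V) ⋙ G) :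
    ∃ H : FundamentalGroupoid X ⥤ T, piIncl U ⋙ H = F ∧ piIncl V ⋙ H = G := by
  obtain ⟨H, hH⟩ := exists_functor_of_cover (iUnion_bool_eq_univ hUV) (isOpen_bool hU hV)
    (fun b => by cases b; exacts [F, G]) (T := T) (by
      -- The ordered pair `(V, U)` requires compatibility on `V ∩ U`, which is obtained by
      -- restricting `h` along `V ∩ U ⊆ U ∩ V`.
      have h' : piMap (inter_subset_left : V ∩ U ⊆ V) ⋙ G =
          piMap (inter_subset_right : V ∩ U ⊆ U) ⋙ F := by
        have e := congrArg (piMap (inter_comm V U).subset ⋙ ·) h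
        simp only [← Functor.assoc, piMap, ← FundamentalGroupoid.map_comp] at e
        exact e.symm
      rintro (_ | _) (_ | _)
      exacts [rfl, h, h', rfl])
  exact ⟨H, hH false, hH true⟩

theorem isPushout_fundamentalGroupoid (hU : IsOpen U) (hV : IsOpen V) (hUV : U ∪ V = univ) :
    IsPushout
      (FundamentalGroupoid.fundamentalGroupoidFunctor.map
        (TopCat.ofHom (ContinuousMap.inclusion (inter_subset_left : U ∩ V ⊆ U))))
      (FundamentalGroupoid.fundamentalGroupoidFunctor.map
        (TopCat.ofHom (ContinuousMap.inclusion (inter_subset_right : U ∩ V ⊆ V))))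
      (FundamentalGroupoid.fundamentalGroupoidFunctor.map (TopCat.ofHom (incl U)))
      (FundamentalGroupoid.fundamentalGroupoidFunctor.map (TopCat.ofHom (incl V))) where
  w := (piMap_comp_piIncl (inter_subset_left : U ∩ V ⊆ U)).trans
    (piMap_comp_piIncl (inter_subset_right : U ∩ V ⊆ V)).symm
  isColimit' := ⟨Limits.PushoutCocone.IsColimit.mk _
    (fun s => (exists_functor_of_union hU hV hUV s.inl s.inr s.condition).choose)
    (fun s => (exists_functor_of_union hU hV hUV s.inl s.inr s.condition).choose_spec.1)
    (fun s => (exists_functor_of_union hU hV hUV s.inl s.inr s.condition).choose_spec.2)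
    (fun s _ h₁ h₂ => functor_ext_of_union hU hV hUV
      (h₁.trans (exists_functor_of_union hU hV hUV s.inl s.inr s.condition).choose_spec.1.symm)
      (h₂.trans (exists_functor_of_union hU hV hUV s.inl s.inr s.condition).choose_spec.2.symm))⟩

end TwoSets

/-! ### The strict pushout property -/

section Comparison

variable {X : Type u} [TopologicalSpace X] {U V : Set X}

theorem Lim.ext_of_eq {X Y Z : Type*} [Category* X] [Category* Y] [Category* Z] {p : Y ⥤ X}
    {q : Z ⥤ X} {s t : Lim p q} (h₁ : s.base = t.base) (h₂ : s.fst = t.fst)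
    (h₃ : s.snd = t.snd) : s = t := by
  cases s
  cases t
  subst h₁ h₂ h₃
  rfl

theorem isGroupoidPushout_fundamentalGroupoid (hU : IsOpen U) (hV : IsOpen V)
    (hUV : U ∪ V = univ) :
    IsGroupoidPushout.{v, w} (piMap_comp_piIncl (inter_subset_left : U ∩ V ⊆ U))
      (piMap_comp_piIncl (inter_subset_right : U ∩ V ⊆ V)) := by
  intro T _
  -- The four goals are faithfulness, fullness, and injectivity and surjectivity on objects.
  refine ⟨⟨fun {χ χ'} α β h => ?_⟩, ⟨fun {χ χ'} f => ?_⟩,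
    ⟨fun χ χ' h => ?_, fun s => ?_⟩⟩
  · exact natTrans_ext_of_union hUV (congrArg Lim.Hom.fst h) (congrArg Lim.Hom.snd h)
  · have h₁ : ∀ x hx hx', (f.fst.app ⟨⟨x, hx⟩⟩ : χ.obj ⟨x⟩ ⟶ χ'.obj ⟨x⟩) =
        f.base.app ⟨⟨x, hx, hx'⟩⟩ := fun x hx hx' => by
      have := NatTrans.congr_app f.fst_w ⟨⟨x, hx, hx'⟩⟩
      rw [NatTrans.comp_app, NatTrans.comp_app, eqToHom_app, eqToHom_app] at this
      -- Source and target of each `eqToHom` component agree definitionally, so these components are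
      -- identities.
      exact (Category.comp_id _).symm.trans (this.trans (Category.id_comp _))
    have h₂ : ∀ x hx hx', (f.snd.app ⟨⟨x, hx'⟩⟩ : χ.obj ⟨x⟩ ⟶ χ'.obj ⟨x⟩) =
        f.base.app ⟨⟨x, hx, hx'⟩⟩ := fun x hx hx' => by
      have := NatTrans.congr_app f.snd_w ⟨⟨x, hx, hx'⟩⟩
      rw [NatTrans.comp_app, NatTrans.comp_app, eqToHom_app, eqToHom_app] at this
      exact (Category.comp_id _).symm.trans (this.trans (Category.id_comp _))
    obtain ⟨θ, hθ₁, hθ₂⟩ := exists_natTrans_of_union hU hV hUV f.fst f.snd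
      (fun x hx hx' => (h₁ x hx hx').trans (h₂ x hx hx').symm)
    refine ⟨θ, Lim.Hom.ext ?_ hθ₁ hθ₂⟩
    ext ⟨x, hx, hx'⟩
    exact (NatTrans.congr_app hθ₁ ⟨⟨x, hx⟩⟩).trans (h₁ x hx hx')
  · exact functor_ext_of_union hU hV hUV (congrArg Lim.fst h) (congrArg Lim.snd h)
  · obtain ⟨F, hF₁, hF₂⟩ := exists_functor_of_union hU hV hUV s.fst s.snd
      (s.fst_eq.trans s.snd_eq.symm)
    have hF : piIncl (U ∩ V) ⋙ F = s.base :=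
      (congrArg (· ⋙ F) (piMap_comp_piIncl inter_subset_left)).symm.trans
        ((congrArg (piMap inter_subset_left ⋙ ·) hF₁).trans s.fst_eq)
    exact ⟨F, Lim.ext_of_eq hF hF₁ hF₂⟩

/-! ### Strictification and the 2-pushout property -/

/-- Replace a functor by an isomorphic one whose restriction along a functor which is injective on
objects is prescribed up to isomorphism. -/
theorem exists_iso_restrict_eq {A C T : Type*} [Category* A] [Category* C] [Category* T]
    (j : A ⥤ C) (hj : Function.Injective j.obj) (F : C ⥤ T) (B : A ⥤ T) (ξ : j ⋙ F ≅ B) :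
    ∃ (F' : C ⥤ T) (e : F ≅ F') (h : j ⋙ F' = B),
      Functor.whiskerLeft j e.inv ≫ ξ.hom = eqToHom h := by
  classical
  -- On the image of `j` the values of `F` are replaced by those of `B`, elsewhere they are kept.
  -- Morphisms are then conjugated by `e`, which is given by `ξ` on the image and by an identity off
  -- it.
  let obj : C → T := fun c => if h : ∃ a, j.obj a = c then B.obj h.choose else F.obj c
  have hobj : ∀ a, obj (j.obj a) = B.obj a := fun a => by
    have h : ∃ a', j.obj a' = j.obj a := ⟨a, rfl⟩
    simp only [obj, dif_pos h]
    rw [hj h.choose_spec]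
  let e : ∀ c, F.obj c ≅ obj c := fun c =>
    if h : ∃ a, j.obj a = c then
      eqToIso (congrArg F.obj h.choose_spec).symm ≪≫ ξ.app h.choose ≪≫ eqToIso (by simp only [obj, dif_pos h])
    else eqToIso (by simp only [obj, dif_neg h])
  have he : ∀ a, (e (j.obj a)).hom = ξ.hom.app a ≫ eqToHom (hobj a).symm := fun a => by
    have h : ∃ a', j.obj a' = j.obj a := ⟨a, rfl⟩
    -- The chosen preimage of `j.obj a` equals `a` only by injectivity, so it is generalized to `a'`
    -- before the equality is eliminated.
    have key : ∀ a' (ha : a' = a), eqToHom (by rw [ha]) ≫ ξ.hom.app a' ≫ eqToHom (by rw [ha]) =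
        ξ.hom.app a := by
      rintro _ rfl
      simp
    rw [← key _ (hj h.choose_spec)]
    simp only [e, dif_pos h]
    simp
  have heq : j ⋙ F.copyObj obj e = B := by
    refine CategoryTheory.Functor.ext hobj fun a b f => ?_
    have h1 : F.map (j.map f) ≫ ξ.hom.app b = ξ.hom.app a ≫ B.map f := ξ.hom.naturality f
    simp only [Functor.comp_map, Functor.copyObj, Iso.inv_comp_eq, he]
    rw [reassoc_of% h1]
    simp
  refine ⟨F.copyObj obj e, F.isoCopyObj obj e, heq, ?_⟩
  ext a
  refine (Iso.inv_comp_eq (e (j.obj a))).2 ?_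
  rw [he, eqToHom_app]
  exact ((Category.assoc _ _ _).trans ((congrArg (ξ.hom.app a ≫ ·) (eqToHom_trans _ _)).trans
    (Category.comp_id _))).symm

/-- Construct an isomorphism in the 2-limit from isomorphisms of the components. -/
def TwoLim.isoMk {X Y Z : Type*} [Category* X] [Category* Y] [Category* Z] {p : Y ⥤ X}
    {q : Z ⥤ X} {s t : TwoLim p q} (e : s.base ≅ t.base) (e₁ : s.fst ≅ t.fst) (e₂ : s.snd ≅ t.snd)
    (h₁ : p.map e₁.hom ≫ t.fstIso.hom = s.fstIso.hom ≫ e.hom)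
    (h₂ : q.map e₂.hom ≫ t.sndIso.hom = s.sndIso.hom ≫ e.hom) : s ≅ t where
  hom := ⟨e.hom, e₁.hom, e₂.hom, h₁, h₂⟩
  inv := ⟨e.inv, e₁.inv, e₂.inv,
    by rw [← cancel_mono e.hom, Category.assoc, ← h₁, ← Functor.map_comp_assoc]; simp,
    by rw [← cancel_mono e.hom, Category.assoc, ← h₂, ← Functor.map_comp_assoc]; simp⟩
  hom_inv_id := TwoLim.Hom.ext e.hom_inv_id e₁.hom_inv_id e₂.hom_inv_id
  inv_hom_id := TwoLim.Hom.ext e.inv_hom_id e₁.inv_hom_id e₂.inv_hom_id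

theorem piMap_obj_injective {S S' : Set X} (h : S ⊆ S') : Function.Injective (piMap h).obj := by
  rintro ⟨x⟩ ⟨y⟩ hxy
  have : inclusion h x = inclusion h y := congrArg FundamentalGroupoid.as hxy
  rw [inclusion_injective h this]

theorem isoWhiskerRight_piMap_app {S S' : Set X} (h : S ⊆ S') {T : Type*} [Category* T]
    (χ : FundamentalGroupoid X ⥤ T) (x : FundamentalGroupoid S) :
    (Functor.isoWhiskerRight (eqToIso (piMap_comp_piIncl h)) χ).hom.app x =
      𝟙 (χ.obj ((piIncl S).obj x)) := by
  simp only [Functor.isoWhiskerRight_hom, Functor.whiskerRight_app, eqToIso.hom, eqToHom_app]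
  exact χ.map_id _

/-- The square commutes strictly, so whiskering its 2-cells with `χ` and `χ'` gives identity
components. The 2-limit condition on morphisms therefore becomes the strict one, and fullness
follows by the same gluing. -/
theorem app_eq_of_whiskered {S S' : Set X} (h : S ⊆ S') {T : Type*} [Category* T]
    {χ χ' : FundamentalGroupoid X ⥤ T} (α : piIncl S' ⋙ χ ⟶ piIncl S' ⋙ χ')
    (β : piIncl S ⋙ χ ⟶ piIncl S ⋙ χ')
    (w : Functor.whiskerLeft (piMap h) α ≫
        (Functor.isoWhiskerRight (eqToIso (piMap_comp_piIncl h)) χ').hom =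
      (Functor.isoWhiskerRight (eqToIso (piMap_comp_piIncl h)) χ).hom ≫ β) (x : S) :
    (α.app ⟨⟨x, h x.2⟩⟩ : χ.obj ⟨x⟩ ⟶ χ'.obj ⟨x⟩) = β.app ⟨x⟩ := by
  have := NatTrans.congr_app w ⟨x⟩
  rw [NatTrans.comp_app, NatTrans.comp_app, isoWhiskerRight_piMap_app,
    isoWhiskerRight_piMap_app] at this
  exact (Category.comp_id _).symm.trans (this.trans (Category.id_comp _))

/-- This turns the conclusion of `exists_iso_restrict_eq` into the compatibility condition for an
isomorphism in the 2-limit. -/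
theorem eqToHom_eq_isoWhiskerRight_comp {S S' : Set X} (h : S ⊆ S') {T : Type*} [Category* T]
    (F : FundamentalGroupoid X ⥤ T) {B : FundamentalGroupoid S ⥤ T}
    (h₁ : piMap h ⋙ piIncl S' ⋙ F = B) (h₂ : piIncl S ⋙ F = B) :
    eqToHom h₁ =
      (Functor.isoWhiskerRight (eqToIso (piMap_comp_piIncl h)) F).hom ≫ (eqToIso h₂).hom := by
  ext x
  rw [NatTrans.comp_app, isoWhiskerRight_piMap_app, eqToIso.hom, eqToHom_app, eqToHom_app]
  exact (Category.id_comp _).symm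

theorem isGroupoidTwoPushout_fundamentalGroupoid (hU : IsOpen U) (hV : IsOpen V)
    (hUV : U ∪ V = univ) :
    IsGroupoidTwoPushout.{v, w} (eqToIso (piMap_comp_piIncl (inter_subset_left : U ∩ V ⊆ U)))
      (eqToIso (piMap_comp_piIncl (inter_subset_right : U ∩ V ⊆ V))) := by
  intro T _
  refine ⟨⟨fun {χ χ'} α β h => ?_⟩, ⟨fun {χ χ'} f => ?_⟩, ⟨fun s => ?_⟩⟩
  · exact natTrans_ext_of_union hUV (congrArg TwoLim.Hom.fst h) (congrArg TwoLim.Hom.snd h)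
  · have h₁ : ∀ x hx hx', (f.fst.app ⟨⟨x, hx⟩⟩ : χ.obj ⟨x⟩ ⟶ χ'.obj ⟨x⟩) =
        f.base.app ⟨⟨x, hx, hx'⟩⟩ := fun x hx hx' => by
      exact app_eq_of_whiskered inter_subset_left f.fst f.base f.fst_w ⟨x, hx, hx'⟩
    have h₂ : ∀ x hx hx', (f.snd.app ⟨⟨x, hx'⟩⟩ : χ.obj ⟨x⟩ ⟶ χ'.obj ⟨x⟩) =
        f.base.app ⟨⟨x, hx, hx'⟩⟩ := fun x hx hx' => by
      exact app_eq_of_whiskered inter_subset_right f.snd f.base f.snd_w ⟨x, hx, hx'⟩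
    obtain ⟨θ, hθ₁, hθ₂⟩ := exists_natTrans_of_union hU hV hUV f.fst f.snd
      (fun x hx hx' => (h₁ x hx hx').trans (h₂ x hx hx').symm)
    refine ⟨θ, TwoLim.Hom.ext ?_ hθ₁ hθ₂⟩
    ext ⟨x, hx, hx'⟩
    exact (NatTrans.congr_app hθ₁ ⟨⟨x, hx⟩⟩).trans (h₁ x hx hx')
  · obtain ⟨F₁, e₁, h₁, w₁⟩ := exists_iso_restrict_eq _ (piMap_obj_injective _) s.fst s.base s.fstIso
    obtain ⟨F₂, e₂, h₂, w₂⟩ := exists_iso_restrict_eq _ (piMap_obj_injective _) s.snd s.base s.sndIso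
    obtain ⟨F, rfl, rfl⟩ := exists_functor_of_union hU hV hUV F₁ F₂ (h₁.trans h₂.symm)
    have hF : piIncl (U ∩ V) ⋙ F = s.base :=
      (congrArg (· ⋙ F) (piMap_comp_piIncl inter_subset_left)).symm.trans h₁
    refine ⟨F, ⟨TwoLim.isoMk (eqToIso hF) e₁.symm e₂.symm ?_ ?_⟩⟩
    · exact w₁.trans (eqToHom_eq_isoWhiskerRight_comp inter_subset_left F h₁ hF)
    · exact w₂.trans (eqToHom_eq_isoWhiskerRight_comp inter_subset_right F h₂ hF)

end Comparison

end VanKampen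

end

/-- Van Kampen's theorem for fundamental groupoids. The first conjunct is the pushout property in
the category of small groupoids, the second one the pushout property on the level of the groupoids
of functors, and the third one the 2-pushout property, where the strictly commutative square is
regarded as a 2-commutative one with identity 2-cells. -/
theorem mainTheorem3 {X : Type u} [TopologicalSpace X] (U V : Set X)
    (hU : IsOpen U) (hV : IsOpen V) (hUV : U ∪ V = Set.univ) :
    IsPushout
      (FundamentalGroupoid.fundamentalGroupoidFunctor.map
        (TopCat.ofHom (ContinuousMap.inclusion (Set.inter_subset_left : U ∩ V ⊆ U))))
      (FundamentalGroupoid.fundamentalGroupoidFunctor.map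
        (TopCat.ofHom (ContinuousMap.inclusion (Set.inter_subset_right : U ∩ V ⊆ V))))
      (FundamentalGroupoid.fundamentalGroupoidFunctor.map (TopCat.ofHom (VanKampen.incl U)))
      (FundamentalGroupoid.fundamentalGroupoidFunctor.map (TopCat.ofHom (VanKampen.incl V))) ∧
    VanKampen.IsGroupoidPushout.{v, w}
      (VanKampen.piMap_comp_piIncl (Set.inter_subset_left : U ∩ V ⊆ U))
      (VanKampen.piMap_comp_piIncl (Set.inter_subset_right : U ∩ V ⊆ V)) ∧
    VanKampen.IsGroupoidTwoPushout.{v, w}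
      (eqToIso (VanKampen.piMap_comp_piIncl (Set.inter_subset_left : U ∩ V ⊆ U)))
      (eqToIso (VanKampen.piMap_comp_piIncl (Set.inter_subset_right : U ∩ V ⊆ V))) :=
  ⟨VanKampen.isPushout_fundamentalGroupoid hU hV hUV,
    VanKampen.isGroupoidPushout_fundamentalGroupoid hU hV hUV,
    VanKampen.isGroupoidTwoPushout_fundamentalGroupoid hU hV hUV⟩
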